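/- Let $G=(V,A)$ be a finite directed acyclic graph (the common preference graph) whose vertices are called items. An item $u$ is dominated by an item $v$ if $u=v$ or there is a directed path from $v$ to $u$ in $G$. An allocation to a set $K=\{1,\dots,k\}$ of agents is a map $\pi:K\to 2^V$ with $\pi(i)\cap\pi(j)=\emptyset$ for $i\ne j$ (items may remain unassigned), and the dissatisfaction $\delta_\pi(i)$ of agent $i$ is the number of items of $G$ that are not dominated by any item of $\pi(i)$. The decision problem CG Min-Max Dissatisfaction asks, given $k$, a directed acyclic graph $G=(V,A)$ and an integer $d$, whether there is an allocation $\pi$ with $\delta_\pi(i)\le d$ for every agent $i\in K$. An out-tree is a directed acyclic graph with a specified vertex $r$ (the root) such that for every vertex $v\neq r$ there is exactly one path from $r$ to $v$; an out-star is an out-tree in which every such path has length at most $1$ (a single vertex is an out-star). **Theorem.** For any number $k$ of agents ($k$ being part of the input), CG Min-Max Dissatisfaction can be solved in polynomial time if the preference graph $G$ is a disjoint union of out-stars. That is, there are a deterministic algorithm (a program of a random access machine whose arithmetic consists of addition and truncated subtraction, every instruction and every test costing one step) and a polynomial $f$ such that, on every instance $(G,k,d)$ in which $G$ is a disjoint union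 of out-stars, the algorithm halts after at most $f(N)$ steps with the correct answer, where $N$ is the size of the input in bits ($G$ given by its adjacency matrix, $k$ and $d$ in binary). -/

import Mathlib

/-! ### Random access machines with a step count -/

/-- A configuration of the random access machine: registers, which are addressed directly, and a
memory, which is addressed indirectly through registers. Every cell holds a natural number. -/
structure RamState where
  reg : ℕ → ℕ
  mem : ℕ → ℕ

/-- `s.setReg x a` writes the value `a` to register `x`. -/
def RamState.setReg (s : RamState) (x a : ℕ) : RamState :=
  ⟨Function.update s.reg x a, s.mem⟩

/-- `s.setMem i a` writes the value `a` to the memory cell with address `i`. -/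
def RamState.setMem (s : RamState) (i a : ℕ) : RamState :=
  ⟨s.reg, Function.update s.mem i a⟩

/-- Structured programs of the random access machine. The arithmetic consists of addition and
truncated subtraction only. -/
inductive RamProg where
  /-- do nothing -/
  | skip
  /-- `R x := c` -/
  | const (x c : ℕ)
  /-- `R x := R y + R z` -/
  | add (x y z : ℕ)
  /-- `R x := max (R y - R z) 0` -/
  | sub (x y z : ℕ)
  /-- `R x := M (R y)` -/
  | load (x y : ℕ)
  /-- `M (R x) := R y` -/
  | store (x y : ℕ)
  /-- first `p`, then `q` -/
  | seq (p q : RamProg)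
  /-- if `R x ≠ 0` then `p` else `q` -/
  | ifNZ (x : ℕ) (p q : RamProg)
  /-- while `R x ≠ 0` do `p` -/
  | loopNZ (x : ℕ) (p : RamProg)

/-- `RamExec p s t s'`: the program `p`, started in the configuration `s`, halts after exactly `t`
steps in the configuration `s'`. Every elementary instruction and every test takes one step. -/
inductive RamExec : RamProg → RamState → ℕ → RamState → Prop where
  | skip (s : RamState) : RamExec .skip s 1 s
  | const (s : RamState) (x c : ℕ) : RamExec (.const x c) s 1 (s.setReg x c)
  | add (s : RamState) (x y z : ℕ) : RamExec (.add x y z) s 1 (s.setReg x (s.reg y + s.reg z))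
  | sub (s : RamState) (x y z : ℕ) : RamExec (.sub x y z) s 1 (s.setReg x (s.reg y - s.reg z))
  | load (s : RamState) (x y : ℕ) : RamExec (.load x y) s 1 (s.setReg x (s.mem (s.reg y)))
  | store (s : RamState) (x y : ℕ) : RamExec (.store x y) s 1 (s.setMem (s.reg x) (s.reg y))
  | seq {p q : RamProg} {s s₁ s₂ : RamState} {t₁ t₂ : ℕ} :
      RamExec p s t₁ s₁ → RamExec q s₁ t₂ s₂ → RamExec (.seq p q) s (t₁ + t₂) s₂
  | ifTrue {x : ℕ} {p q : RamProg} {s s' : RamState} {t : ℕ} :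
      s.reg x ≠ 0 → RamExec p s t s' → RamExec (.ifNZ x p q) s (1 + t) s'
  | ifFalse {x : ℕ} {p q : RamProg} {s s' : RamState} {t : ℕ} :
      s.reg x = 0 → RamExec q s t s' → RamExec (.ifNZ x p q) s (1 + t) s'
  | loopStop {x : ℕ} {p : RamProg} {s : RamState} :
      s.reg x = 0 → RamExec (.loopNZ x p) s 1 s
  | loopStep {x : ℕ} {p : RamProg} {s s₁ s₂ : RamState} {t₁ t₂ : ℕ} :
      s.reg x ≠ 0 → RamExec p s t₁ s₁ → RamExec (.loopNZ x p) s₁ t₂ s₂ →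
      RamExec (.loopNZ x p) s (1 + t₁ + t₂) s₂

/-- The initial configuration on the input `w`: the words of `w` stand in the memory cells
`0, 1, …, w.length - 1`, and every other memory cell and every register is `0`. -/
def ramInit (w : List ℕ) : RamState where
  reg := fun _ => 0
  mem := fun i => w.getD i 0

/-- The size of an input in bits: each word contributes the length of its binary expansion,
plus one. -/
def bitSize (w : List ℕ) : ℕ :=
  (w.map fun a => Nat.size a + 1).sum

/-- The decision problem with instances `α` (given to the machine through `enc`) and question `Q`
is solvable in polynomial time on the instances that satisfy the promise `P`: one program halts on
every such instance within a number of steps that is polynomial in the input size, with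
register `0` holding `1` if the answer is yes and `0` if the answer is no. -/
def SolvableInPolyTimeOn {α : Type*} (enc : α → List ℕ) (P Q : α → Prop) : Prop :=
  ∃ (prog : RamProg) (f : Polynomial ℕ), ∀ a : α, P a →
    ∃ (t : ℕ) (s : RamState), RamExec prog (ramInit (enc a)) t s ∧
      t ≤ f.eval (bitSize (enc a)) ∧
      ((Q a ∧ s.reg 0 = 1) ∨ (¬ Q a ∧ s.reg 0 = 0))

/-! ### Directed graphs and collections of out-stars -/

/-- There is no cycle (equivalently, no closed walk of positive length). -/
def Digraph.IsAcyclic {V : Type*} (G : Digraph V) : Prop :=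
  ∀ v, ¬ Relation.TransGen G.Adj v v

/-- `p` is the vertex sequence of a path from `u` to `v`; the length of the path is
`p.length - 1`. -/
def Digraph.IsPath {V : Type*} (G : Digraph V) (u v : V) (p : List V) : Prop :=
  p.head? = some u ∧ p.getLast? = some v ∧ p.IsChain G.Adj ∧ p.Nodup

/-- `G` is an out-tree with root `r`. -/
def Digraph.IsOutTree {V : Type*} (G : Digraph V) (r : V) : Prop :=
  G.IsAcyclic ∧ ∀ v, v ≠ r → ∃! p, G.IsPath r v p

/-- `G` is an out-star with root `r`: an out-tree in which every path from the root to another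
vertex has length at most one. -/
def Digraph.IsOutStar {V : Type*} (G : Digraph V) (r : V) : Prop :=
  G.IsOutTree r ∧ ∀ v, v ≠ r → ∀ p, G.IsPath r v p → p.length - 1 ≤ 1

/-- The subgraph induced by a set of vertices. -/
def Digraph.inducedOn {V : Type*} (G : Digraph V) (S : Set V) : Digraph S where
  Adj u v := G.Adj u v

/-- `G` is a disjoint union of out-stars: the vertex set can be partitioned into classes such that
no arc joins two different classes and every class induces an out-star. -/
def Digraph.IsOutStarCollection {V : Type*} (G : Digraph V) : Prop :=
  ∃ C : Setoid V, (∀ u v, G.Adj u v → C u v) ∧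
    ∀ S ∈ C.classes, ∃ r : S, (G.inducedOn S).IsOutStar r

/-! ### Min-max dissatisfaction with a common preference graph -/

/-- `G.Dominates v u`: item `u` is dominated by item `v`, that is, `u = v` or there is a path from
`v` to `u`. -/
def Digraph.Dominates {V : Type*} (G : Digraph V) (v u : V) : Prop :=
  Relation.ReflTransGen G.Adj v u

/-- An allocation assigns pairwise disjoint sets of items to the agents; items may remain
unassigned. -/
def IsAllocation {K V : Type*} (π : K → Set V) : Prop :=
  ∀ i j, i ≠ j → Disjoint (π i) (π j)

/-- The dissatisfaction of agent `i`: the number of items that are not dominated by any item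
assigned to `i`. -/
noncomputable def dissatisfaction {K V : Type*} (G : Digraph V) (π : K → Set V) (i : K) : ℕ :=
  {u : V | ¬ ∃ v ∈ π i, G.Dominates v u}.ncard

/-- An instance of the decision problem: `k` agents, `n` items, a directed acyclic preference graph
on the items, and an integer threshold `d`. -/
structure MinMaxInstance where
  n : ℕ
  k : ℕ
  G : Digraph (Fin n)
  acyclic : G.IsAcyclic
  d : ℤ

/-- The question of the decision problem. -/
def MinMaxInstance.IsYes (I : MinMaxInstance) : Prop :=
  ∃ π : Fin I.k → Set (Fin I.n), IsAllocation π ∧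
    ∀ i, (dissatisfaction I.G π i : ℤ) ≤ I.d

open Classical in
/-- The input words of an instance: `n`, `k`, the positive and the negative part of `d`, and then
the adjacency matrix of `G`, row by row (row `u`, column `v` is `1` iff `(u, v)` is an arc). -/
noncomputable def MinMaxInstance.encode (I : MinMaxInstance) : List ℕ :=
  [I.n, I.k, I.d.toNat, (-I.d).toNat] ++
    (List.finRange I.n).flatMap fun u =>
      (List.finRange I.n).map fun v => if I.G.Adj u v then 1 else 0

/-! ### Distributing units subject to single conflicts -/

/-! Let D = max (n - d, 0) be the number of items each agent must dominate. For k > 0 agents the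
answer is yes iff D ≤ n and k * D ≤ ∑ v, min (1 + outdeg v) D, a test that takes O(n²) steps.

Necessity (`card_mul_le_sum_min`): a bundle of weight at least D keeps weight at least D when each
weight is truncated at D, and bundles are disjoint.

Sufficiency (`exists_bundles`): pack the roots into one bin of capacity D per agent, by decreasing
truncated star size, and fill the deficits with leaves. A leaf is useless only to the agent holding
its root, so by Hall's theorem (`exists_disjoint_allowed_units`) it is enough that the leaves cover
the total deficit and that the leaves outside an agent's own stars cover its deficit. If the packing
gets stuck at a root r, every deficit is at most the number of leaves of r, and of some star in the
bin; this gives both bounds. If all roots fit, the criterion bounds the total deficit. With ℓ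
leaves, the single bound holds once every bin has at least D - ℓ roots, which
`exists_packing_card_le` arranges. -/

open Finset in
/-- If every unit of `S` is forbidden to at most one agent, then the demands `δ` can be met as soon
as the total demand is at most the number of units and the demand of each agent is at most the
number of units allowed to it. -/
theorem exists_disjoint_allowed_units {K L : Type*} [Fintype K] [DecidableEq L]
    (S : Finset L) (F : L → K → Prop) [∀ l i, Decidable (F l i)]
    (hF : ∀ l i j, F l i → F l j → i = j) (δ : K → ℕ) (htotal : ∑ i, δ i ≤ #S)
    (hsingle : ∀ i, δ i ≤ #{l ∈ S | ¬ F l i}) :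
    ∃ B : K → Finset L, (∀ i j, i ≠ j → Disjoint (B i) (B j)) ∧
      (∀ i, B i ⊆ {l ∈ S | ¬ F l i}) ∧ ∀ i, #(B i) = δ i := by
  classical
  let T : (Σ i : K, Fin (δ i)) → Finset L := fun x => {l ∈ S | ¬ F l x.1}
  -- Hall's condition: demands of a single agent are covered by `hsingle`. If two agents occur in
  -- `A`, no unit is forbidden to both, so the neighbourhood is all of `S`.
  have hall : ∀ A : Finset (Σ i : K, Fin (δ i)), #A ≤ #(A.biUnion T) := by
    intro A
    rcases A.eq_empty_or_nonempty with rfl | ⟨a, ha⟩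
    · simp
    by_cases hA : ∀ b ∈ A, b.1 = a.1
    · calc #A ≤ #(univ.image fun c : Fin (δ a.1) => (⟨a.1, c⟩ : Σ i : K, Fin (δ i))) := by
            refine card_le_card fun b hb => ?_
            obtain ⟨i, c⟩ := b
            obtain rfl : i = a.1 := hA _ hb
            exact mem_image_of_mem _ (mem_univ c)
        _ ≤ δ a.1 := by
            refine card_image_le.trans ?_
            simp
        _ ≤ #(T a) := hsingle a.1
        _ ≤ #(A.biUnion T) := card_le_card (subset_biUnion_of_mem T ha)
    · push Not at hA
      obtain ⟨b, hb, hba⟩ := hA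
      calc #A ≤ Fintype.card (Σ i : K, Fin (δ i)) := card_le_univ A
        _ = ∑ i, δ i := by simp
        _ ≤ #S := htotal
        _ ≤ #(A.biUnion T) := by
          refine card_le_card fun l hl => ?_
          rw [mem_biUnion]
          by_cases hla : F l a.1
          · exact ⟨b, hb, mem_filter.2 ⟨hl, fun hlb => hba (hF l _ _ hlb hla)⟩⟩
          · exact ⟨a, ha, mem_filter.2 ⟨hl, hla⟩⟩
  obtain ⟨g, hg, hgT⟩ := (all_card_le_biUnion_card_iff_exists_injective T).1 hall
  refine ⟨fun i => univ.image fun c : Fin (δ i) => g ⟨i, c⟩, ?_, ?_, ?_⟩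
  · intro i j hij
    rw [disjoint_left]
    intro l hi hj
    obtain ⟨c, -, hc⟩ := mem_image.1 hi
    obtain ⟨c', -, hc'⟩ := mem_image.1 hj
    exact hij (congrArg Sigma.fst (hg (hc.trans hc'.symm)))
  · intro i l hl
    obtain ⟨c, -, rfl⟩ := mem_image.1 hl
    exact hgT ⟨i, c⟩
  · intro i
    rw [card_image_of_injective _ fun c c' h => by simpa using hg h]
    simp

/-! ### Packing items into bins -/

open Finset in
/-- Packing in order of decreasing size: either everything fits, or at some point an item that is
not larger than the packed ones fits into no bin. -/
theorem exists_packing_or_stuck {ι K : Type*} [Fintype K] [DecidableEq K] [DecidableEq ι]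
    [Nonempty K] (t : ι → ℕ) (D : ℕ) (Q : Finset ι) :
    (∃ f : ι → K, ∀ i, ∑ q ∈ Q with f q = i, t q ≤ D) ∨
      ∃ P ⊆ Q, ∃ r ∈ Q, r ∉ P ∧ (∀ q ∈ P, t r ≤ t q) ∧ ∃ f : ι → K,
        ∀ i, ∑ q ∈ P with f q = i, t q ≤ D ∧ D < ∑ q ∈ P with f q = i, t q + t r := by
  induction Q using Finset.induction_on_min_value t with
  | empty => exact .inl ⟨fun _ => Classical.arbitrary K, by simp⟩
  | @insert a Q ha hmin ih =>
    rcases ih with ⟨f, hf⟩ | ⟨P, hPQ, r, hr, h⟩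
    · by_cases hfit : ∃ i, ∑ q ∈ Q with f q = i, t q + t a ≤ D
      · obtain ⟨i, hi⟩ := hfit
        refine .inl ⟨Function.update f a i, fun j => ?_⟩
        have hQ : ({q ∈ Q | Function.update f a i q = j}) = {q ∈ Q | f q = j} := by
          refine filter_congr fun q hq => ?_
          rw [Function.update_of_ne (ne_of_mem_of_not_mem hq ha)]
        rw [filter_insert, hQ, Function.update_self]
        split_ifs with hij
        · subst hij
          rw [sum_insert (by simp [ha])]
          omega
        · exact hf j
      · push Not at hfit
        exact .inr ⟨Q, subset_insert _ _, a, mem_insert_self _ _, ha, hmin, f,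
          fun i => ⟨hf i, hfit i⟩⟩
    · exact .inr ⟨P, hPQ.trans (subset_insert _ _), r, mem_insert_of_mem hr, h⟩

open Finset in
/-- If any `e` items fit into one bin, then a packing of at least `e` items per bin can be
rearranged so that every bin receives at least `e` items. -/
theorem exists_packing_card_le {ι K : Type*} [Fintype K] [DecidableEq K] [DecidableEq ι]
    [Finite ι] (t : ι → ℕ) (D e : ℕ) (Q : Finset ι) (hcard : Fintype.card K * e ≤ #Q)
    (hfit : ∀ A ⊆ Q, #A ≤ e → ∑ q ∈ A, t q ≤ D)
    (hpack : ∃ f : ι → K, ∀ i, ∑ q ∈ Q with f q = i, t q ≤ D) :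
    ∃ f : ι → K, ∀ i, ∑ q ∈ Q with f q = i, t q ≤ D ∧ e ≤ #{q ∈ Q | f q = i} := by
  have : Nonempty {f : ι → K // ∀ i, ∑ q ∈ Q with f q = i, t q ≤ D} := nonempty_subtype.2 hpack
  -- Minimise the total shortfall below `e`: moving one item from a bin with more than `e` items to
  -- a deficient bin would decrease it. The receiving bin then has at most `e` items, so it still
  -- fits.
  obtain ⟨⟨f, hf⟩, hmin⟩ := Finite.exists_min
    fun f : {f : ι → K // ∀ i, ∑ q ∈ Q with f q = i, t q ≤ D} =>
      ∑ i, (e - #{q ∈ Q | f.1 q = i})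
  refine ⟨f, fun i => ⟨hf i, ?_⟩⟩
  by_contra! hi
  obtain ⟨j, hj⟩ : ∃ j, e < #{q ∈ Q | f q = j} := by
    by_contra! hle
    have hlt : ∑ j, #{q ∈ Q | f q = j} < ∑ _j : K, e :=
      sum_lt_sum (fun j _ => hle j) ⟨i, mem_univ i, hi⟩
    rw [← card_eq_sum_card_fiberwise (fun _ _ => mem_coe.2 (mem_univ _))] at hlt
    simp only [sum_const, card_univ, smul_eq_mul] at hlt
    omega
  have hij : i ≠ j := by rintro rfl; omega
  obtain ⟨r, hr⟩ := card_pos.1 (Nat.zero_lt_of_lt hj)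
  obtain ⟨hrQ, hrj⟩ := mem_filter.1 hr
  have hnew_i : {q ∈ Q | Function.update f r i q = i} = insert r {q ∈ Q | f q = i} := by
    ext q
    by_cases hq : q = r
    · subst hq; simp [hrQ]
    · simp [hq]
  have hnew_ne : ∀ l ≠ i, {q ∈ Q | Function.update f r i q = l} = {q ∈ Q | f q = l}.erase r := by
    intro l hl
    ext q
    by_cases hq : q = r
    · subst hq; simp [hl.symm]
    · simp [hq]
  have hri : r ∉ ({q ∈ Q | f q = i}) := by simp [hrj, hij.symm]
  have hg : ∀ l, ∑ q ∈ Q with Function.update f r i q = l, t q ≤ D := by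
    intro l
    by_cases hl : l = i
    · subst hl
      rw [hnew_i]
      refine hfit _ (insert_subset hrQ (filter_subset _ _)) ?_
      rw [card_insert_of_notMem hri]
      omega
    · rw [hnew_ne l hl]
      exact (sum_le_sum_of_subset (erase_subset _ _)).trans (hf l)
  refine (hmin ⟨_, hg⟩).not_gt (sum_lt_sum (fun l _ => ?_) ⟨i, mem_univ i, ?_⟩)
  · by_cases hl : l = i
    · subst hl
      simp only [hnew_i, card_insert_of_notMem hri]
      omega
    · simp only [hnew_ne l hl]
      by_cases hlj : l = j
      · subst hlj
        rw [card_erase_of_mem hr]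
        omega
      · rw [erase_eq_of_notMem (by simp [hrj, Ne.symm hlj])]
  · simp only [hnew_i, card_insert_of_notMem hri]
    omega

/-! ### Running random access machine programs -/

/-- `p`, started in `s`, halts within `c` steps in a configuration that satisfies `Q`. -/
def RamProg.HaltsWithin (p : RamProg) (s : RamState) (c : ℕ) (Q : RamState → Prop) : Prop :=
  ∃ t s', RamExec p s t s' ∧ t ≤ c ∧ Q s'

namespace RamProg.HaltsWithin

variable {p q : RamProg} {s : RamState} {a b c x y z : ℕ} {Q Q' : RamState → Prop}

theorem mono (h : p.HaltsWithin s a Q) (hab : a ≤ b) (hQ : ∀ s', Q s' → Q' s') :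
    p.HaltsWithin s b Q' := by
  obtain ⟨t, s', h1, h2, h3⟩ := h
  exact ⟨t, s', h1, h2.trans hab, hQ _ h3⟩

theorem const (h : Q (s.setReg x a)) : (RamProg.const x a).HaltsWithin s 1 Q :=
  ⟨_, _, .const s x a, le_rfl, h⟩

theorem add (h : Q (s.setReg x (s.reg y + s.reg z))) : (RamProg.add x y z).HaltsWithin s 1 Q :=
  ⟨_, _, .add s x y z, le_rfl, h⟩

theorem sub (h : Q (s.setReg x (s.reg y - s.reg z))) : (RamProg.sub x y z).HaltsWithin s 1 Q :=
  ⟨_, _, .sub s x y z, le_rfl, h⟩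

theorem load (h : Q (s.setReg x (s.mem (s.reg y)))) : (RamProg.load x y).HaltsWithin s 1 Q :=
  ⟨_, _, .load s x y, le_rfl, h⟩

theorem seq (h : p.HaltsWithin s a fun s' => q.HaltsWithin s' b Q) :
    (RamProg.seq p q).HaltsWithin s (a + b) Q := by
  obtain ⟨t, s', h1, h2, t', s'', h3, h4, h5⟩ := h
  exact ⟨_, _, .seq h1 h3, by omega, h5⟩

theorem ifNZ (hp : s.reg x ≠ 0 → p.HaltsWithin s a Q) (hq : s.reg x = 0 → q.HaltsWithin s a Q) :
    (RamProg.ifNZ x p q).HaltsWithin s (1 + a) Q := by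
  by_cases hx : s.reg x = 0
  · obtain ⟨t, s', h1, h2, h3⟩ := hq hx
    exact ⟨_, _, .ifFalse hx h1, by omega, h3⟩
  · obtain ⟨t, s', h1, h2, h3⟩ := hp hx
    exact ⟨_, _, .ifTrue hx h1, by omega, h3⟩

/-- A loop with an invariant `I j` for `j` remaining rounds. -/
theorem loopNZ {I : ℕ → RamState → Prop} (hzero : ∀ s, I 0 s → s.reg x = 0)
    (hstep : ∀ j s, I (j + 1) s → s.reg x ≠ 0 ∧ p.HaltsWithin s c (I j)) (j : ℕ)
    (h : I j s) : (RamProg.loopNZ x p).HaltsWithin s ((1 + c) * j + 1) (I 0) := by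
  induction j generalizing s with
  | zero => exact ⟨_, _, .loopStop (hzero s h), by omega, h⟩
  | succ j ih =>
    obtain ⟨hx, t, s', h1, h2, h3⟩ := hstep j s h
    obtain ⟨t', s'', h4, h5, h6⟩ := ih h3
    exact ⟨_, _, .loopStep hx h1 h4, by rw [mul_add]; omega, h6⟩

end RamProg.HaltsWithin

/-! ### The program: correctness and running time -/

namespace CommonStars

/-- `c` in register 8, position in register 6, countdown in register 9; adds up a row of the
matrix. -/
def addEntry : RamProg :=
  .seq (.load 10 6) (.seq (.add 8 8 10) (.seq (.add 6 6 5) (.sub 9 9 5)))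

/-- Adds the smaller of `D` (register 4) and one plus the sum of the current row to register 7, and
counts down register 11. -/
def addRow : RamProg :=
  .seq (.add 8 5 12) (.seq (.add 9 1 12) (.seq (.loopNZ 9 addEntry)
    (.seq (.sub 10 8 4) (.seq (.sub 8 8 10) (.seq (.add 7 7 8) (.sub 11 11 5))))))

/-- Adds `k` (register 2) to register 13 and counts down register 4. -/
def addAgents : RamProg :=
  .seq (.add 13 13 2) (.sub 4 4 5)

/-- Compares `k * D` with the sum of the truncated row sums. -/
def decideStars : RamProg :=
  .seq (.const 6 4) (.seq (.add 11 1 12) (.seq (.loopNZ 11 addRow)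
    (.seq (.loopNZ 4 addAgents) (.seq (.sub 10 13 7)
      (.ifNZ 10 (.const 0 0) (.const 0 1))))))

/-- Register 1 is `n`, register 2 is `k`, register 3 a difference, register 4 is `D`, register 5
is `1`, register 12 is `0`. -/
def program : RamProg :=
  .seq (.const 5 1) (.seq (.load 1 12) (.seq (.load 2 5)
    (.seq (.const 6 3) (.seq (.load 4 6) (.seq (.add 4 1 4)
      (.seq (.const 6 2) (.seq (.load 3 6) (.seq (.sub 4 4 3)
        (.seq (.sub 3 4 1)
          (.ifNZ 2 (.ifNZ 3 (.const 0 0) decideStars) (.const 0 1)))))))))))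

/-- The configuration during the summation. -/
structure Summing (n k D p T : ℕ) (rest : List ℕ) (s : RamState) : Prop where
  reg1 : s.reg 1 = n
  reg2 : s.reg 2 = k
  reg4 : s.reg 4 = D
  reg5 : s.reg 5 = 1
  reg6 : s.reg 6 = p
  reg7 : s.reg 7 = T
  reg12 : s.reg 12 = 0
  reg13 : s.reg 13 = 0
  mem : ∀ i, s.mem (p + i) = rest.getD i 0

theorem addEntries_halts {n k D p T c : ℕ} {l rest : List ℕ} {s : RamState} {m : ℕ}
    (h : Summing n k D p T (l ++ rest) s) (h8 : s.reg 8 = c) (h9 : s.reg 9 = l.length)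
    (h11 : s.reg 11 = m) :
    (RamProg.loopNZ 9 addEntry).HaltsWithin s (5 * l.length + 1) fun s' =>
      Summing n k D (p + l.length) T rest s' ∧ s'.reg 8 = c + l.sum ∧ s'.reg 11 = m := by
  -- `l₁` is the part of the row already added, `l₂` the part still to be read.
  let I : ℕ → RamState → Prop := fun j s => ∃ l₁ l₂, l = l₁ ++ l₂ ∧ l₂.length = j ∧
    Summing n k D (p + l₁.length) T (l₂ ++ rest) s ∧ s.reg 8 = c + l₁.sum ∧ s.reg 9 = j ∧
    s.reg 11 = m
  refine (RamProg.HaltsWithin.loopNZ (I := I) (c := 4) ?_ ?_ l.length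
    ⟨[], l, rfl, rfl, by simpa using h, by simpa using h8, h9, h11⟩).mono (by omega) ?_
  · rintro s ⟨_, _, _, _, _, _, h9, _⟩
    exact h9
  · rintro j s ⟨l₁, _ | ⟨a, l₂⟩, hl, hlen, hs, h8, h9, h11⟩
    · simp at hlen
    obtain ⟨r1, r2, r4, r5, r6, r7, r12, r13, rm⟩ := hs
    refine ⟨by omega, ?_⟩
    have ha : s.mem (p + l₁.length) = a := by simpa using rm 0
    refine .seq (a := 1) (b := 3) <| .load <| .seq (a := 1) (b := 2) <| .add <|
      .seq (a := 1) (b := 1) <| .add <| .sub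
      ⟨l₁ ++ [a], l₂, by simp [hl], by simpa using hlen, ?_, ?_, ?_, ?_⟩
    · refine ⟨?_, ?_, ?_, ?_, ?_, ?_, ?_, ?_, ?_⟩ <;>
        simp [RamState.setReg, *]
      · omega
      · intro i
        have := rm (i + 1)
        simp only [List.cons_append, List.getD_cons_succ] at this
        simpa [add_assoc, add_comm, add_left_comm] using this
    · simp [RamState.setReg, *]; omega
    · simp [RamState.setReg, *]
    · simp [RamState.setReg, *]
  · rintro s ⟨l₁, l₂, hl, hlen, hs, h8, -, h11⟩
    obtain rfl := List.length_eq_zero_iff.1 hlen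
    obtain rfl : l = l₁ := by simpa using hl
    exact ⟨hs, h8, h11⟩

/-- The minimum comes from truncated subtraction: x - (x - D) = min x D. -/
theorem addRow_halts {n k D p T m : ℕ} {l rest : List ℕ} {s : RamState}
    (h : Summing n k D p T (l ++ rest) s) (hl : l.length = n) (h11 : s.reg 11 = m + 1) :
    addRow.HaltsWithin s (5 * n + 7) fun s' =>
      Summing n k D (p + n) (T + min (1 + l.sum) D) rest s' ∧ s'.reg 11 = m := by
  obtain ⟨r1, r2, r4, r5, r6, r7, r12, r13, rm⟩ := h
  refine RamProg.HaltsWithin.mono (a := 1 + (1 + ((5 * l.length + 1) + (1 + (1 + (1 + 1))))))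
    (.seq <| .add <| .seq <| .add <| .seq <|
      (addEntries_halts (n := n) (k := k) (D := D) (p := p) (T := T) (c := 1) (l := l)
        (rest := rest) (m := m + 1) ?_ ?_ ?_ ?_).mono le_rfl ?_) (by omega) fun s h => h
  · refine ⟨?_, ?_, ?_, ?_, ?_, ?_, ?_, ?_, ?_⟩ <;> simp [RamState.setReg, *]
  · simp [RamState.setReg, *]
  · simp [RamState.setReg, *]
  · simp [RamState.setReg, *]
  · rintro s ⟨⟨r1, r2, r4, r5, r6, r7, r12, r13, rm⟩, r8, r11⟩
    refine .seq <| .sub <| .seq <| .sub <| .seq <| .add <| .sub ⟨?_, ?_⟩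
    · refine ⟨?_, ?_, ?_, ?_, ?_, ?_, ?_, ?_, ?_⟩ <;>
        simp [RamState.setReg, *]
      · omega
      · simpa [hl] using rm
    · simp [RamState.setReg, *]

theorem addRows_halts {n k D p m : ℕ} {L : List (List ℕ)} {s : RamState}
    (h : Summing n k D p 0 L.flatten s) (hL : ∀ l ∈ L, l.length = n) (hm : L.length = m)
    (h11 : s.reg 11 = m) :
    (RamProg.loopNZ 11 addRow).HaltsWithin s ((5 * n + 8) * m + 1) fun s' =>
      Summing n k D (p + n * m) (L.map fun l => min (1 + l.sum) D).sum [] s' := by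
  let I : ℕ → RamState → Prop := fun j s => ∃ L₁ L₂, L = L₁ ++ L₂ ∧ L₂.length = j ∧
    Summing n k D (p + n * L₁.length) (L₁.map fun l => min (1 + l.sum) D).sum L₂.flatten s ∧
    s.reg 11 = j
  refine (RamProg.HaltsWithin.loopNZ (I := I) (c := 5 * n + 7) ?_ ?_ m
    ⟨[], L, rfl, hm, by simpa using h, h11⟩).mono (by rw [show 1 + (5 * n + 7) = 5 * n + 8 by ring]) ?_
  · rintro s ⟨_, _, _, _, _, h⟩
    exact h
  · rintro j s ⟨L₁, _ | ⟨l, L₂⟩, hL', hlen, hs, h11⟩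
    · simp at hlen
    refine ⟨by omega, (addRow_halts (l := l) (rest := L₂.flatten) (m := j) (by simpa using hs)
      (hL l (by simp [hL'])) h11).mono le_rfl ?_⟩
    rintro s ⟨h1, h2⟩
    refine ⟨L₁ ++ [l], L₂, by simp [hL'], by simpa using hlen, ?_, h2⟩
    convert h1 using 1
    · simp; ring
    · simp
  · rintro s ⟨L₁, L₂, hL', hlen, hs, -⟩
    obtain rfl := List.length_eq_zero_iff.1 hlen
    obtain rfl : L = L₁ := by simpa using hL'
    rwa [hm] at hs

/-- Without a multiplication instruction, k * D is built by D additions of k. This is affordable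
because the program first rejects D > n. -/
theorem addAgents_halts {n k D p T : ℕ} {rest : List ℕ} {s : RamState}
    (h : Summing n k D p T rest s) :
    (RamProg.loopNZ 4 addAgents).HaltsWithin s (3 * D + 1) fun s' =>
      s'.reg 13 = k * D ∧ s'.reg 7 = T := by
  let I : ℕ → RamState → Prop := fun j s =>
    s.reg 2 = k ∧ s.reg 4 = j ∧ s.reg 5 = 1 ∧ s.reg 7 = T ∧ s.reg 13 + k * j = k * D
  refine (RamProg.HaltsWithin.loopNZ (I := I) (c := 2) ?_ ?_ D
    ⟨h.reg2, h.reg4, h.reg5, h.reg7, by simp [h.reg13]⟩).mono (by omega) ?_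
  · rintro s ⟨_, h, _⟩
    exact h
  · rintro j s ⟨h2, h4, h5, h7, h13⟩
    refine ⟨by omega, .seq (a := 1) (b := 1) <| .add <| .sub ⟨?_, ?_, ?_, ?_, ?_⟩⟩ <;>
      simp [RamState.setReg, *]
    rw [← h13]; ring
  · rintro s ⟨-, -, -, h7, h13⟩
    exact ⟨by simpa using h13, h7⟩

theorem decideStars_halts {n k D : ℕ} {L : List (List ℕ)} {s : RamState}
    (h1 : s.reg 1 = n) (h2 : s.reg 2 = k) (h4 : s.reg 4 = D) (h5 : s.reg 5 = 1)
    (h7 : s.reg 7 = 0) (h12 : s.reg 12 = 0) (h13 : s.reg 13 = 0)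
    (hmem : ∀ i, s.mem (4 + i) = L.flatten.getD i 0)
    (hL : ∀ l ∈ L, l.length = n) (hlen : L.length = n) (hD : D ≤ n) :
    decideStars.HaltsWithin s (5 * (n * n) + 11 * n + 10) fun s' =>
      s'.reg 0 = if k * D ≤ (L.map fun l => min (1 + l.sum) D).sum then 1 else 0 := by
  refine RamProg.HaltsWithin.mono
    (a := 1 + (1 + (((5 * n + 8) * n + 1) + ((3 * D + 1) + (1 + (1 + 1))))))
    (.seq <| .const <| .seq <| .add <| .seq <|
      (addRows_halts (n := n) (k := k) (D := D) (p := 4) (L := L) ?_ hL hlen ?_).mono le_rfl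
      fun s hs => .seq <| (addAgents_halts hs).mono le_rfl
      fun s ⟨r13, r7⟩ => .seq <| .sub <| .ifNZ (fun h10 => .const ?_) fun h10 => .const ?_)
    (by nlinarith) fun s h => h
  · refine ⟨?_, ?_, ?_, ?_, ?_, ?_, ?_, ?_, ?_⟩ <;> simp [RamState.setReg, *]
  · simp [RamState.setReg, *]
  · have : ¬ k * D ≤ (L.map fun l => min (1 + l.sum) D).sum := by
      simp only [RamState.setReg, Function.update_self, r13, r7] at h10
      omega
    simp [RamState.setReg, this]
  · have : k * D ≤ (L.map fun l => min (1 + l.sum) D).sum := by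
      simp only [RamState.setReg, Function.update_self, r13, r7] at h10
      omega
    simp [RamState.setReg, this]

/-- Here a and b are the positive and negative parts of the threshold. Adding b before subtracting a
ensures that truncation occurs only when d > n, where D = 0 is the right value. -/
theorem program_halts {n k a b : ℕ} {L : List (List ℕ)} (hL : ∀ l ∈ L, l.length = n)
    (hlen : L.length = n) :
    program.HaltsWithin (ramInit ([n, k, a, b] ++ L.flatten)) (5 * (n * n) + 11 * n + 30) fun s =>
      s.reg 0 = if k = 0 ∨ (n + b - a ≤ n ∧
        k * (n + b - a) ≤ (L.map fun l => min (1 + l.sum) (n + b - a)).sum) then 1 else 0 := by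
  refine RamProg.HaltsWithin.mono
    (a := 1 + (1 + (1 + (1 + (1 + (1 + (1 + (1 + (1 + (1 +
      (1 + (1 + (5 * (n * n) + 11 * n + 10)))))))))))))
    (.seq <| .const <| .seq <| .load <| .seq <| .load <| .seq <| .const <| .seq <| .load <|
      .seq <| .add <| .seq <| .const <| .seq <| .load <| .seq <| .sub <| .seq <| .sub <|
      .ifNZ (fun hk => .ifNZ (fun hD => RamProg.HaltsWithin.mono (.const (a := 0) ?_) (by omega)
        fun s h => h)
        fun hD => (decideStars_halts (n := n) (k := k) (D := n + b - a) (L := L)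
          ?_ ?_ ?_ ?_ ?_ ?_ ?_ ?_ hL hlen ?_).mono le_rfl ?_)
        fun hk => RamProg.HaltsWithin.mono (.const (a := 1) ?_) (by omega) fun s h => h)
    (by omega) fun s h => h
  · simp [RamState.setReg, ramInit] at hk hD ⊢
    omega
  · simp [RamState.setReg, ramInit]
  · simp [RamState.setReg, ramInit]
  · simp [RamState.setReg, ramInit]
  · simp [RamState.setReg, ramInit]
  · simp [RamState.setReg, ramInit]
  · simp [RamState.setReg, ramInit]
  · simp [RamState.setReg, ramInit]
  · intro i
    simp [RamState.setReg, ramInit, add_comm 4 i]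
  · simp [RamState.setReg, ramInit] at hD
    omega
  · intro s hs
    simp [RamState.setReg, ramInit] at hk hD
    have hba : b ≤ a := by omega
    rw [hs]
    simp [hk, hba]
  · simp [RamState.setReg, ramInit] at hk ⊢
    simp [hk]

end CommonStars

/-! ### Out-stars -/

theorem Digraph.IsAcyclic.not_adj_self {V : Type*} {G : Digraph V} (h : G.IsAcyclic) (v : V) :
    ¬ G.Adj v v := fun hv => h v (.single hv)

/-- A path of length at most 1 from `r` to `v ≠ r` is an arc. An arc into `r` would close a cycle,
and an arc between two non-roots would give a path of length 2 from `r`. -/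
theorem Digraph.IsOutStar.adj_iff {V : Type*} {G : Digraph V} {r : V} (h : G.IsOutStar r)
    (u v : V) : G.Adj u v ↔ u = r ∧ v ≠ r := by
  obtain ⟨⟨hac, hpath⟩, hlen⟩ := h
  have hr : ∀ v, v ≠ r → G.Adj r v := by
    intro v hv
    obtain ⟨p, hp, -⟩ := hpath v hv
    have hl := hlen v hv p hp
    obtain ⟨h1, h2, h3, -⟩ := hp
    match p, h1, h2, h3, hl with
    | [a], h1, h2, _, _ =>
      simp only [List.head?_cons, List.getLast?_singleton, Option.some.injEq] at h1 h2
      exact absurd (h2.symm.trans h1) hv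
    | [a, b], h1, h2, h3, _ =>
      obtain rfl : a = r := by simpa using h1
      obtain rfl : b = v := by simpa using h2
      simpa using h3
    | a :: b :: c :: p, _, _, _, hl => simp at hl
  refine ⟨fun huv => ?_, fun ⟨hu, hv⟩ => hu ▸ hr v hv⟩
  have hne : u ≠ v := by rintro rfl; exact hac.not_adj_self _ huv
  have hv : v ≠ r := by
    rintro rfl
    exact hac u (.tail (.single huv) (hr u hne))
  refine ⟨by_contra fun hu => ?_, hv⟩
  have := hlen v hv [r, u, v] ⟨rfl, rfl, by simp [hr u hu, huv], by
    simp [hne, Ne.symm hu, hv.symm]⟩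
  simp at this

/-- In a disjoint union of out-stars, let `ρ` send each vertex to the root of its star. -/
theorem Digraph.IsOutStarCollection.exists_root {V : Type*} {G : Digraph V}
    (h : G.IsOutStarCollection) :
    ∃ ρ : V → V, (∀ v, ρ (ρ v) = ρ v) ∧ ∀ u v, G.Adj u v ↔ u = ρ v ∧ u ≠ v := by
  obtain ⟨C, hC, hstar⟩ := h
  have hS : ∀ S ∈ C.classes, ∃ r ∈ S, ∀ u ∈ S, ∀ v ∈ S, (G.Adj u v ↔ u = r ∧ v ≠ r) := by
    intro S hS
    obtain ⟨r, hr⟩ := hstar S hS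
    refine ⟨r, r.2, fun u hu v hv => ?_⟩
    have := hr.adj_iff ⟨u, hu⟩ ⟨v, hv⟩
    rwa [Subtype.ext_iff, Ne, Subtype.ext_iff] at this
  choose root hmem hadj using hS
  have hroot : ∀ S T hS hT, S = T → root S hS = root T hT := by
    rintro S _ hS hT rfl; rfl
  have hcl : ∀ v, {x | C x v} ∈ C.classes := C.mem_classes
  have heq : ∀ u v, C u v → {x | C x u} = {x | C x v} := fun u v huv =>
    Set.ext fun x => ⟨fun hx => C.trans' hx huv, fun hx => C.trans' hx (C.symm' huv)⟩
  refine ⟨fun v => root {x | C x v} (hcl v), fun v => ?_, fun u v => ?_⟩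
  · exact hroot _ _ _ _ (heq _ _ (hmem _ (hcl v)))
  · have hself : v ∈ {x | C x v} := C.refl' v
    constructor
    · intro huv
      obtain ⟨h1, h2⟩ := (hadj _ (hcl v) u (hC u v huv) v hself).1 huv
      exact ⟨h1, fun h => h2 (h ▸ h1)⟩
    · rintro ⟨h1, h2⟩
      have hu : u ∈ {x | C x v} := h1 ▸ hmem _ (hcl v)
      exact (hadj _ (hcl v) u hu v hself).2 ⟨h1, fun h => h2 (h1.trans h.symm)⟩

/-- The items dominated by `v` in a disjoint union of out-stars. -/
theorem Digraph.dominates_iff_of_root {V : Type*} {G : Digraph V} {ρ : V → V}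
    (hρ : ∀ v, ρ (ρ v) = ρ v) (hadj : ∀ u v, G.Adj u v ↔ u = ρ v ∧ u ≠ v) (v u : V) :
    G.Dominates v u ↔ u = v ∨ ρ u = v := by
  constructor
  · intro h
    induction h with
    | refl => exact .inl rfl
    | @tail b c _ hbc ih =>
      obtain ⟨rfl, hne⟩ := (hadj b c).1 hbc
      rcases ih with h | h
      · exact .inr h
      · exact .inr ((hρ c).symm.trans h)
  · rintro (rfl | rfl)
    · exact .refl
    · by_cases h : ρ u = u
      · rw [h]; exact .refl
      · exact .single ((hadj _ _).2 ⟨rfl, h⟩)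

/-! ### Satisfying all agents -/

open Finset in
/-- Once a set `P` of roots has been distributed by `f`, the leaves can make every agent dominate
`D` items, provided that there are enough leaves in total and for each single agent. -/
theorem exists_bundles_of_roots {V K : Type*} [Fintype V] [DecidableEq V] [Fintype K]
    [DecidableEq K] {ρ : V → V} {D : ℕ} {t : V → ℕ} (ht : ∀ r, t r ≤ #{u | ρ u = r})
    (P : Finset V) (hP : ∀ r ∈ P, ρ r = r) (f : V → K)
    (htotal : ∑ i, (D - ∑ q ∈ P with f q = i, t q) ≤ #{l | ρ l ≠ l})
    (hsingle : ∀ i, D - ∑ q ∈ P with f q = i, t q ≤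
      #{l | ρ l ≠ l ∧ ¬ (ρ l ∈ P ∧ f (ρ l) = i)}) :
    ∃ π : K → Finset V, (∀ i j, i ≠ j → Disjoint (π i) (π j)) ∧
      ∀ i, D ≤ #{u | u ∈ π i ∨ ρ u ∈ π i} := by
  -- A leaf is forbidden to the agent that already dominates it through its root; there is at most
  -- one such agent.
  obtain ⟨B, hB, hBsub, hBcard⟩ := exists_disjoint_allowed_units {l | ρ l ≠ l}
    (fun l i => ρ l ∈ P ∧ f (ρ l) = i) (fun l i j hi hj => hi.2.symm.trans hj.2) _ htotal
    (by simpa only [filter_filter] using hsingle)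
  have hBmem : ∀ i, ∀ l ∈ B i, ρ l ≠ l ∧ ¬ (ρ l ∈ P ∧ f (ρ l) = i) := fun i l hl => by
    simpa using hBsub i hl
  refine ⟨fun i => {q ∈ P | f q = i} ∪ B i, fun i j hij => ?_, fun i => ?_⟩
  · simp only [disjoint_left, mem_union, mem_filter]
    rintro v (⟨hv, hvi⟩ | hv) (⟨hv', hvj⟩ | hv')
    · exact hij (hvi.symm.trans hvj)
    · exact (hBmem j v hv').1 (hP v hv)
    · exact (hBmem i v hv).1 (hP v hv')
    · exact disjoint_left.1 (hB i j hij) hv hv'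
  · have hdisj : Disjoint ({q ∈ P | f q = i}.biUnion fun r => {u | ρ u = r}) (B i) := by
      rw [disjoint_left]
      intro u hu hu'
      simp only [mem_biUnion, mem_filter, mem_univ, true_and] at hu
      obtain ⟨r, hr, rfl⟩ := hu
      exact (hBmem i u hu').2 hr
    calc D ≤ ∑ q ∈ P with f q = i, t q + (D - ∑ q ∈ P with f q = i, t q) := by omega
      _ ≤ ∑ q ∈ P with f q = i, #{u | ρ u = q} + #(B i) := by
        rw [hBcard]
        exact Nat.add_le_add_right (sum_le_sum fun q _ => ht q) _
      _ = #(({q ∈ P | f q = i}.biUnion fun r => {u | ρ u = r}) ∪ B i) := by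
        rw [card_union_of_disjoint hdisj, card_biUnion]
        intro a _ b _ hab
        rw [Function.onFun, disjoint_left]
        intro u hu hu'
        exact hab ((by simpa using hu : ρ u = a).symm.trans (by simpa using hu'))
      _ ≤ _ := by
        refine card_le_card fun u hu => ?_
        simp only [mem_union, mem_biUnion, mem_filter, mem_univ, true_and] at hu ⊢
        rcases hu with ⟨r, hr, rfl⟩ | hu
        · exact .inr (.inl hr)
        · exact .inl (.inr hu)

open Finset in
/-- The leaves that do not belong to the stars of agent `i`. -/
theorem card_allowed_leaves {V K : Type*} [Fintype V] [DecidableEq V] [DecidableEq K]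
    {ρ : V → V} (P : Finset V) (hP : ∀ r ∈ P, ρ r = r) (f : V → K) (i : K) :
    #{l | ρ l ≠ l ∧ ¬ (ρ l ∈ P ∧ f (ρ l) = i)} + ∑ q ∈ P with f q = i, #{u | ρ u = q} =
      #{l | ρ l ≠ l} + #{q ∈ P | f q = i} := by
  have h1 : ∑ q ∈ P with f q = i, #{u | ρ u = q} = #{u | ρ u ∈ P ∧ f (ρ u) = i} := by
    rw [card_eq_sum_card_fiberwise (f := ρ) (t := {q ∈ P | f q = i})
      (fun u hu => by simpa using hu)]
    refine sum_congr rfl fun q hq => congrArg card ?_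
    ext u
    simp only [mem_filter, mem_univ, true_and] at hq ⊢
    exact ⟨fun h => ⟨h ▸ hq, h⟩, fun h => h.2⟩
  -- The stars of agent `i` consist of their leaves and their roots.
  have h2 : #{u | ρ u ∈ P ∧ f (ρ u) = i} =
      #{l | ρ l ≠ l ∧ (ρ l ∈ P ∧ f (ρ l) = i)} + #{q ∈ P | f q = i} := by
    rw [← card_union_of_disjoint]
    · congr 1
      ext u
      simp only [mem_filter, mem_univ, true_and, mem_union]
      constructor
      · intro h
        by_cases hu : ρ u = u
        · exact .inr (hu ▸ h)
        · exact .inl ⟨hu, h⟩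
      · rintro (h | h)
        · exact h.2
        · rwa [hP u h.1]
    · rw [disjoint_left]
      intro u hu hu'
      exact (mem_filter.1 hu).2.1 (hP u (mem_filter.1 hu').1)
  have h3 := card_filter_add_card_filter_not (s := ({l | ρ l ≠ l} : Finset V))
    (fun l => ρ l ∈ P ∧ f (ρ l) = i)
  simp only [filter_filter] at h3
  omega

open Finset in
theorem card_star_eq {V : Type*} [Fintype V] [DecidableEq V] {ρ : V → V} {r : V}
    (hr : ρ r = r) : #{u | ρ u = r} = #{l | ρ l ≠ l ∧ ρ l = r} + 1 := by
  rw [← card_singleton r, ← card_union_of_disjoint]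
  · congr 1
    ext u
    simp only [mem_filter, mem_univ, true_and, mem_union, mem_singleton]
    constructor
    · rintro rfl
      by_cases hu : u = ρ u
      · exact .inr hu
      · exact .inl ⟨Ne.symm hu, rfl⟩
    · rintro (h | rfl)
      · exact h.2
      · exact hr
  · simp [hr]

open Finset in
/-- If first fit gets stuck, then the leaves of the packed stars are plentiful. -/
theorem exists_bundles_of_stuck {V K : Type*} [Fintype V] [DecidableEq V] [Fintype K]
    [DecidableEq K] {ρ : V → V} {D : ℕ} (P : Finset V) (hP : ∀ r ∈ P, ρ r = r) (r : V)
    (hr : ρ r = r) (hrP : r ∉ P)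
    (hmin : ∀ q ∈ P, min #{u | ρ u = r} D ≤ min #{u | ρ u = q} D) (f : V → K)
    (hf : ∀ i, D < ∑ q ∈ P with f q = i, min #{u | ρ u = q} D + min #{u | ρ u = r} D) :
    ∃ π : K → Finset V, (∀ i j, i ≠ j → Disjoint (π i) (π j)) ∧
      ∀ i, D ≤ #{u | u ∈ π i ∨ ρ u ∈ π i} := by
  refine exists_bundles_of_roots (t := fun q => min #{u | ρ u = q} D)
    (fun q => min_le_left _ _) P hP f ?_ fun i => ?_
  -- No bin is empty, since the truncated size of `r` is at most `D`. The deficit of bin `i` is less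
  -- than that size, hence less than the star size of any `q i` in the bin, hence at most its number
  -- of leaves.
  · have hne : ∀ i, ∃ q ∈ P, f q = i := by
      intro i
      by_contra! h
      have := hf i
      rw [filter_false_of_mem h, sum_empty] at this
      omega
    choose q hqP hqf using hne
    have hle : ∀ i, D - ∑ q ∈ P with f q = i, min #{u | ρ u = q} D ≤
        #{l | ρ l ≠ l ∧ ρ l = q i} := by
      intro i
      have h1 := card_star_eq (hP _ (hqP i))
      have h2 := hmin _ (hqP i)
      have h3 := hf i
      omega
    calc _ ≤ ∑ i, #{l | ρ l ≠ l ∧ ρ l = q i} := sum_le_sum fun i _ => hle i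
      _ = #(univ.biUnion fun i => ({l | ρ l ≠ l ∧ ρ l = q i} : Finset V)) := by
        rw [card_biUnion]
        intro i _ j _ hij
        rw [Function.onFun, disjoint_left]
        intro l hl hl'
        simp only [mem_filter, mem_univ, true_and] at hl hl'
        exact hij (by rw [← hqf i, ← hqf j, ← hl.2, ← hl'.2])
      _ ≤ _ := card_le_card fun l hl => by
        simp only [mem_biUnion, mem_filter, mem_univ, true_and] at hl ⊢
        exact hl.choose_spec.1
  -- As `r` is unpacked, its leaves are allowed to every agent, and they outnumber or equal each
  -- deficit.
  · have h1 := card_star_eq hr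
    have h3 := hf i
    have h4 : #{l | ρ l ≠ l ∧ ρ l = r} ≤ #{l | ρ l ≠ l ∧ ¬ (ρ l ∈ P ∧ f (ρ l) = i)} :=
      card_le_card fun l hl => by
        simp only [mem_filter, mem_univ, true_and] at hl ⊢
        exact ⟨hl.1, fun h => hrP (hl.2 ▸ h.1)⟩
    omega

open Finset in
/-- The counting condition suffices for an allocation in which each agent dominates `D` items. -/
theorem exists_bundles {V K : Type*} [Fintype V] [DecidableEq V] [Fintype K] [DecidableEq K]
    {ρ : V → V} (hρ : ∀ v, ρ (ρ v) = ρ v) {D : ℕ} (hD : D ≤ Fintype.card V)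
    (hK : Fintype.card K * D ≤ ∑ r with ρ r = r, min #{u | ρ u = r} D + #{l | ρ l ≠ l}) :
    ∃ π : K → Finset V, (∀ i j, i ≠ j → Disjoint (π i) (π j)) ∧
      ∀ i, D ≤ #{u | u ∈ π i ∨ ρ u ∈ π i} := by
  -- A single agent takes everything; the count in `hcard` needs at least two agents.
  by_cases hone : Fintype.card K ≤ 1
  · have := Fintype.card_le_one_iff_subsingleton.1 hone
    exact ⟨fun _ => univ, fun i j hij => absurd (Subsingleton.elim i j) hij, fun i => by simpa using hD⟩
  push Not at hone
  have : Nonempty K := Fintype.card_pos_iff.1 (by omega)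
  set Q : Finset V := {r | ρ r = r} with hQ
  set ℓ : ℕ := #{l | ρ l ≠ l} with hℓ
  have hQroot : ∀ r ∈ Q, ρ r = r := fun r hr => (mem_filter.1 hr).2
  have hstar_le : ∀ r ∈ Q, #{u | ρ u = r} ≤ ℓ + 1 := by
    intro r hr
    rw [card_star_eq (hQroot r hr)]
    exact Nat.add_le_add_right (card_le_card fun l hl =>
      mem_filter.2 ⟨mem_univ l, (mem_filter.1 hl).2.1⟩) 1
  have htotal : ∑ r ∈ Q, #{u | ρ u = r} = ℓ + #Q := by
    rw [← card_eq_sum_card_fiberwise (fun u _ => by simp [hQ, hρ])]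
    have := card_filter_add_card_filter_not (s := (univ : Finset V)) (fun r => ρ r = r)
    rw [card_univ] at this ⊢
    rw [hQ, hℓ, add_comm]
    exact this.symm
  rcases exists_packing_or_stuck (K := K) (fun r => min #{u | ρ u = r} D) D Q with
    hpack | ⟨P, hPQ, r, hr, hrP, hmin, f, hf⟩
  swap
  · exact exists_bundles_of_stuck P (fun q hq => hQroot q (hPQ hq)) r (hQroot r hr) hrP hmin f
      fun i => (hf i).2
  -- The criterion gives |K| * D ≤ 2 * ℓ + #Q, and 2 * ℓ ≤ |K| * ℓ.
  have hcard : Fintype.card K * (D - ℓ) ≤ #Q := by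
    rcases Nat.eq_zero_or_pos (D - ℓ) with h0 | hpos
    · simp [h0]
    obtain ⟨e, rfl⟩ : ∃ e, D = ℓ + e := ⟨D - ℓ, by omega⟩
    obtain ⟨k, hk⟩ : ∃ k, Fintype.card K = k + 2 := ⟨Fintype.card K - 2, by omega⟩
    have h1 : ∑ r ∈ Q, min #{u | ρ u = r} (ℓ + e) ≤ ℓ + #Q :=
      htotal ▸ sum_le_sum fun r _ => min_le_left _ _
    rw [hk] at hK ⊢
    rw [Nat.add_sub_cancel_left]
    have h2 : (k + 2) * (ℓ + e) = k * ℓ + 2 * ℓ + (k + 2) * e := by ring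
    have h3 := Nat.zero_le (k * ℓ)
    omega
  -- Stars with roots in `A` have at most ℓ leaves together, hence at most ℓ + #A items.
  have hfit : ∀ A ⊆ Q, #A ≤ D - ℓ → ∑ q ∈ A, min #{u | ρ u = q} D ≤ D := by
    intro A hA hAe
    have h1 : ∀ q ∈ A, #{u | ρ u = q} = #{l | ρ l ≠ l ∧ ρ l = q} + 1 := fun q hq =>
      card_star_eq (hQroot q (hA hq))
    have h2 : ∑ q ∈ A, #{l | ρ l ≠ l ∧ ρ l = q} ≤ ℓ := by
      rw [← card_biUnion]
      · exact card_le_card fun l hl => by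
          simp only [mem_biUnion, mem_filter, mem_univ, true_and] at hl ⊢
          exact hl.choose_spec.2.1
      · intro a _ b _ hab
        rw [Function.onFun, disjoint_left]
        intro l hl hl'
        simp only [mem_filter, mem_univ, true_and] at hl hl'
        exact hab (hl.2.symm.trans hl'.2)
    rcases A.eq_empty_or_nonempty with rfl | hne
    · simp
    have hpos := hne.card_pos
    calc ∑ q ∈ A, min #{u | ρ u = q} D ≤ ∑ q ∈ A, #{u | ρ u = q} :=
          sum_le_sum fun q _ => min_le_left _ _
      _ = ∑ q ∈ A, #{l | ρ l ≠ l ∧ ρ l = q} + #A := by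
        rw [sum_congr rfl h1, sum_add_distrib, sum_const, smul_eq_mul, mul_one]
      _ ≤ D := by omega
  obtain ⟨f, hf⟩ := exists_packing_card_le _ D (D - ℓ) Q hcard hfit hpack
  refine exists_bundles_of_roots (t := fun q => min #{u | ρ u = q} D)
    (fun q => min_le_left _ _) Q hQroot f ?_ fun i => ?_
  · have h1 : ∑ i, (D - ∑ q ∈ Q with f q = i, min #{u | ρ u = q} D) +
        ∑ i, ∑ q ∈ Q with f q = i, min #{u | ρ u = q} D = Fintype.card K * D := by
      rw [← sum_add_distrib, sum_congr rfl fun i _ => Nat.sub_add_cancel (hf i).1]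
      simp
    rw [sum_fiberwise] at h1
    omega
  -- A star of size at least `D` leaves no deficit. Otherwise nothing in the bin is truncated, and
  -- the allowed leaves number ℓ plus the roots in the bin minus its load, which is at least `D`
  -- minus the load.
  · by_cases hbig : ∃ q ∈ Q, f q = i ∧ D ≤ #{u | ρ u = q}
    · obtain ⟨q, hq, hqi, hqD⟩ := hbig
      have h1 := single_le_sum (f := fun q => min #{u | ρ u = q} D) (fun _ _ => Nat.zero_le _)
        (mem_filter.2 ⟨hq, hqi⟩ : q ∈ ({q ∈ Q | f q = i} : Finset V))
      simp only [min_eq_right hqD] at h1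
      rw [Nat.sub_eq_zero_of_le h1]
      exact Nat.zero_le _
    · push Not at hbig
      have h1 : ∑ q ∈ Q with f q = i, min #{u | ρ u = q} D =
          ∑ q ∈ Q with f q = i, #{u | ρ u = q} :=
        sum_congr rfl fun q hq =>
          min_eq_left (hbig q (mem_filter.1 hq).1 (mem_filter.1 hq).2).le
      have h2 := card_allowed_leaves Q hQroot f i
      have h3 := hf i
      rw [h1] at h3 ⊢
      omega

/-! ### The counting criterion -/

open Finset in
/-- Agents with pairwise disjoint bundles of total weight at least `D` each. -/
theorem card_mul_le_sum_min {V K : Type*} [Fintype V] [DecidableEq V] [Fintype K] {D : ℕ}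
    (w : V → ℕ) (π : K → Finset V) (hπ : ∀ i j, i ≠ j → Disjoint (π i) (π j))
    (hD : ∀ i, D ≤ ∑ v ∈ π i, w v) : Fintype.card K * D ≤ ∑ v, min (w v) D := by
  -- Either one item alone has weight at least `D`, or truncation changes nothing in the bundle.
  have h : ∀ i, D ≤ ∑ v ∈ π i, min (w v) D := by
    intro i
    by_cases hbig : ∃ v ∈ π i, D ≤ w v
    · obtain ⟨v, hv, hvD⟩ := hbig
      exact (min_eq_right hvD).ge.trans
        (single_le_sum (f := fun v => min (w v) D) (fun _ _ => Nat.zero_le _) hv)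
    · push Not at hbig
      rw [sum_congr rfl fun v hv => min_eq_left (hbig v hv).le]
      exact hD i
  calc Fintype.card K * D = ∑ _i : K, D := by simp
    _ ≤ ∑ i, ∑ v ∈ π i, min (w v) D := sum_le_sum fun i _ => h i
    _ = ∑ v ∈ univ.biUnion π, min (w v) D :=
      (sum_biUnion fun i _ j _ hij => hπ i j hij).symm
    _ ≤ ∑ v, min (w v) D := sum_le_sum_of_subset (subset_univ _)

open Finset in
-- Each leaf has out-degree 0 and contributes min 1 D, which is 1 only because D ≠ 0.
theorem sum_min_outDegree {V : Type*} [Fintype V] [DecidableEq V] {ρ : V → V}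
    (hρ : ∀ v, ρ (ρ v) = ρ v) {D : ℕ} (hD : D ≠ 0) :
    ∑ v, min (1 + #{u | v = ρ u ∧ v ≠ u}) D =
      ∑ r with ρ r = r, min #{u | ρ u = r} D + #{l | ρ l ≠ l} := by
  rw [← sum_filter_add_sum_filter_not univ (fun v => ρ v = v), card_eq_sum_ones]
  congr 1
  · refine sum_congr rfl fun r hr => ?_
    rw [card_star_eq (mem_filter.1 hr).2, add_comm]
    congr 3
    refine filter_congr fun u _ => ?_
    constructor
    · rintro ⟨h1, h2⟩
      exact ⟨h1 ▸ h2, h1.symm⟩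
    · rintro ⟨h1, h2⟩
      exact ⟨h2.symm, h2 ▸ h1⟩
  · refine sum_congr rfl fun l hl => ?_
    rw [filter_false_of_mem fun u _ (hu : l = ρ u ∧ l ≠ u) =>
      (mem_filter.1 hl).2 (by rw [hu.1, hρ]), card_empty]
    omega

open Finset in
theorem dissatisfaction_add_card_dominated {V K : Type*} [Fintype V] (G : Digraph V)
    (π : K → Set V) (i : K) [DecidablePred fun u => ∃ v ∈ π i, G.Dominates v u] :
    dissatisfaction G π i + #{u | ∃ v ∈ π i, G.Dominates v u} = Fintype.card V := by
  classical
  rw [dissatisfaction, Set.ncard_eq_toFinset_card', Set.toFinset_ofPred, add_comm,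
    card_filter_add_card_filter_not, card_univ]

open Finset Classical in
theorem MinMaxInstance.isYes_iff {I : MinMaxInstance} (hI : I.G.IsOutStarCollection) :
    I.IsYes ↔ I.k = 0 ∨ (I.n + (-I.d).toNat - I.d.toNat ≤ I.n ∧
      I.k * (I.n + (-I.d).toNat - I.d.toNat) ≤
        ∑ v, min (1 + #{u | I.G.Adj v u}) (I.n + (-I.d).toNat - I.d.toNat)) := by
  obtain ⟨ρ, hρ, hadj⟩ := hI.exists_root
  set D := I.n + (-I.d).toNat - I.d.toNat with hDdef
  have hiff : ∀ (π : Fin I.k → Set (Fin I.n)) i, (dissatisfaction I.G π i : ℤ) ≤ I.d ↔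
      D ≤ #{u | ∃ v ∈ π i, I.G.Dominates v u} := by
    intro π i
    have := dissatisfaction_add_card_dominated I.G π i
    rw [Fintype.card_fin] at this
    omega
  simp only [MinMaxInstance.IsYes, hiff]
  rcases Nat.eq_zero_or_pos I.k with hk | hk
  · refine iff_of_true ⟨fun _ => ∅, fun i => ?_, fun i => ?_⟩ (.inl hk) <;>
      exact absurd i.2 (by omega)
  -- The weight used in the criterion is exactly the number of items that `v` dominates, since paths
  -- have length at most 1.
  · have hdeg : ∀ v, 1 + #{u | I.G.Adj v u} = #{u | I.G.Dominates v u} := by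
      intro v
      rw [← card_singleton v, ← card_union_of_disjoint (by simp [hadj])]
      congr 1
      ext u
      simp only [hadj, I.G.dominates_iff_of_root hρ hadj, mem_union, mem_singleton, mem_filter,
        mem_univ, true_and]
      by_cases hu : u = v
      · simp [hu]
      · simp [hu, Ne.symm hu, eq_comm]
    constructor
    · rintro ⟨π, hπ, hsat⟩
      refine .inr ⟨(hsat ⟨0, hk⟩).trans ((card_le_univ _).trans (by simp)), ?_⟩
      have := card_mul_le_sum_min (D := D) (fun v => 1 + #{u | I.G.Adj v u})
        (fun i => (π i).toFinset) (fun i j hij => Set.disjoint_toFinset.2 (hπ i j hij))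
        fun i => (hsat i).trans ?_
      · simpa using this
      · simp only [hdeg]
        refine le_trans (card_le_card fun u hu => ?_) card_biUnion_le
        simpa using hu
    · rintro (h | ⟨hDn, hsum⟩)
      · omega
      have hK : Fintype.card (Fin I.k) * D ≤
          ∑ r with ρ r = r, min #{u | ρ u = r} D + #{l | ρ l ≠ l} := by
        by_cases hD : D = 0
        · simp [hD]
        · rw [← sum_min_outDegree hρ hD, Fintype.card_fin]
          simpa only [hadj] using hsum
      obtain ⟨π, hπ, hdom⟩ := exists_bundles hρ (by simpa using hDn) hK
      refine ⟨fun i => π i, fun i j hij => by simpa using hπ i j hij, fun i => ?_⟩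
      refine (hdom i).trans (card_le_card fun u hu => ?_)
      simp only [mem_filter, mem_univ, true_and, mem_coe] at hu ⊢
      rcases hu with hu | hu
      · exact ⟨u, hu, (I.G.dominates_iff_of_root hρ hadj u u).2 (.inl rfl)⟩
      · exact ⟨ρ u, hu, (I.G.dominates_iff_of_root hρ hadj _ u).2 (.inr rfl)⟩

/-! ### The encoding -/

open Classical in
/-- The rows of the adjacency matrix. -/
noncomputable def MinMaxInstance.rows (I : MinMaxInstance) : List (List ℕ) :=
  (List.finRange I.n).map fun u =>
    (List.finRange I.n).map fun v => if I.G.Adj u v then 1 else 0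

theorem MinMaxInstance.encode_eq (I : MinMaxInstance) :
    I.encode = [I.n, I.k, I.d.toNat, (-I.d).toNat] ++ I.rows.flatten := by
  rw [encode, List.flatMap_def, rows]

theorem MinMaxInstance.length_of_mem_rows (I : MinMaxInstance) : ∀ l ∈ I.rows, l.length = I.n := by
  intro l hl
  obtain ⟨u, -, rfl⟩ := List.mem_map.1 hl
  simp

theorem MinMaxInstance.length_rows (I : MinMaxInstance) : I.rows.length = I.n := by
  simp [rows]

open Classical in
theorem MinMaxInstance.sum_rows (I : MinMaxInstance) (D : ℕ) :
    (I.rows.map fun l => min (1 + l.sum) D).sum =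
      ∑ v, min (1 + Finset.card {u | I.G.Adj v u}) D := by
  rw [rows, List.map_map, Fin.sum_univ_def]
  congr 2
  funext v
  simp only [Function.comp_apply]
  rw [← Fin.sum_univ_def, Finset.card_filter]

theorem length_le_bitSize (w : List ℕ) : w.length ≤ bitSize w := by
  induction w with
  | nil => simp
  | cons a w ih =>
    simp only [bitSize, List.map_cons, List.sum_cons, List.length_cons] at ih ⊢
    omega

/-- The matrix alone has n² words, so a bound quadratic in n is linear in the input size. -/
theorem MinMaxInstance.sq_le_bitSize (I : MinMaxInstance) : I.n * I.n + 4 ≤ bitSize I.encode := by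
  refine le_trans (le_of_eq ?_) (length_le_bitSize _)
  rw [encode_eq, List.length_append, List.length_flatten,
    List.map_congr_left I.length_of_mem_rows, List.map_const', List.sum_replicate, length_rows]
  simp [add_comm]

theorem mainTheorem4 :
    SolvableInPolyTimeOn MinMaxInstance.encode
      (fun I => I.G.IsOutStarCollection) (fun I => I.IsYes) := by
  -- Since n ≤ n², the step count 5n² + 11n + 30 is at most 16n² + 30.
  refine ⟨CommonStars.program, 16 * Polynomial.X + 30, fun I hI => ?_⟩
  obtain ⟨t, s, hexec, ht, hs⟩ := CommonStars.program_halts (n := I.n) (k := I.k)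
    (a := I.d.toNat) (b := (-I.d).toNat) I.length_of_mem_rows I.length_rows
  rw [← I.encode_eq] at hexec
  refine ⟨t, s, hexec, ht.trans ?_, ?_⟩
  · have h1 := I.sq_le_bitSize
    have h2 := Nat.le_mul_self I.n
    simp only [Polynomial.eval_add, Polynomial.eval_mul, Polynomial.eval_X,
      Polynomial.eval_ofNat]
    omega
  · rw [I.sum_rows] at hs
    by_cases hyes : I.IsYes
    · exact .inl ⟨hyes, hs.trans (if_pos ((I.isYes_iff hI).1 hyes))⟩
    · exact .inr ⟨hyes, hs.trans (if_neg fun h => hyes ((I.isYes_iff hI).2 h))⟩
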